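/- Let $D=(V,A)$ be a finite loopless digraph (parallel arcs allowed), let $\{S,T\}$ be a partition of $V$ into two nonempty sets, and let $b\in\mathbb{Z}^V$ with $b(v)\ge 1$ for every $v\in V$. For $U\subseteq V$ let $\delta^-(U)$ and $\delta^+(U)$ denote the sets of arcs entering and leaving $U$, respectively, write $\delta^{\pm}(v)=\delta^{\pm}(\{v\})$, and write $x(C)=\sum_{a\in C}x(a)$ for $x\in\mathbb{R}^A$ and $C\subseteq A$. A set $C\subseteq A$ is a bicut if $C=\delta^-(U)$ for some $U\subseteq V$ with $\emptyset\ne U\subseteq T$ or $T\subseteq U\subsetneq V$. A linear system $Mx\ge r$ in the variable $x\in\mathbb{R}^A$ is totally dual integral (TDI) if, for every integral vector $w\in\mathbb{Z}^A$ for which $\min\{w^\top x : Mx\ge r\}$ is finite, the dual program $\max\{r^\top y : y\ge 0,\ y^\top M=w^\top\}$ has an integral optimal solution; it is box-TDI if, for all vectors $l,u\in\mathbb{R}^A$, the system $Mx\ge r$, $x\ge l$, $-x\ge -u$ is TDI. Theorem. The linear system, in the variable $x\in\mathbb{R}^A$, $$x(\delta^-(v))\ge b(v)\ (v\in T),\qquad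 x(\delta^+(v))\ge b(v)\ (v\in S),\qquad x(C)\ge 1\ (C \text{ a bicut}),\qquad x(a)\ge 0\ (a\in A)$$ is box-TDI. -/

import Mathlib

/-- A linear system `M x ≥ r` in the variable `x ∈ ℝⁿ` is totally dual integral (TDI) if, for every
integral objective vector `w` for which `min {w x : M x ≥ r}` is finite (the system is feasible and
the objective is bounded below on it), the dual program `max {y r : y ≥ 0, y M = w}` has an
integral optimal solution. -/
def IsTDI {ι n : Type*} [Fintype ι] [Fintype n] (M : Matrix ι n ℝ) (r : ι → ℝ) : Prop :=
  ∀ w : n → ℤ,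
    {x : n → ℝ | ∀ i, r i ≤ ∑ j, M i j * x j}.Nonempty →
    BddBelow ((fun x : n → ℝ => ∑ j, (w j : ℝ) * x j) '' {x | ∀ i, r i ≤ ∑ j, M i j * x j}) →
    ∃ y : ι → ℤ, (∀ i, 0 ≤ y i) ∧ (∀ j, ∑ i, (y i : ℝ) * M i j = (w j : ℝ)) ∧
      ∀ z : ι → ℝ, (∀ i, 0 ≤ z i) → (∀ j, ∑ i, z i * M i j = (w j : ℝ)) →
        ∑ i, z i * r i ≤ ∑ i, (y i : ℝ) * r i

/-- A linear system `M x ≥ r` is box-TDI if for all vectors `l, u ∈ ℝⁿ` the system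
`M x ≥ r`, `x ≥ l`, `-x ≥ -u` is TDI. -/
def IsBoxTDI {ι n : Type*} [Fintype ι] [Fintype n] [DecidableEq n]
    (M : Matrix ι n ℝ) (r : ι → ℝ) : Prop :=
  ∀ l u : n → ℝ,
    IsTDI (Matrix.fromRows M (Matrix.fromRows (1 : Matrix n n ℝ) (-1 : Matrix n n ℝ)))
      (Sum.elim r (Sum.elim l (-u)))

/-- A loopless directed graph with vertex set `V` and arc set `A`; parallel arcs are allowed. -/
structure ArcDigraph (V A : Type*) where
  /-- the initial vertex of an arc -/
  tail : A → V
  /-- the terminal vertex of an arc -/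
  head : A → V
  /-- there are no loops -/
  loopless : ∀ a, tail a ≠ head a

namespace ArcDigraph

variable {V A : Type*} [Fintype V] [DecidableEq V] [Fintype A] [DecidableEq A]

/-- The arcs that enter `U`. -/
def deltaIn (D : ArcDigraph V A) (U : Finset V) : Finset A :=
  {a | D.tail a ∉ U ∧ D.head a ∈ U}

/-- The arcs that leave `U`. -/
def deltaOut (D : ArcDigraph V A) (U : Finset V) : Finset A :=
  {a | D.tail a ∈ U ∧ D.head a ∉ U}

/-- `C` is a bicut if `C = δ⁻(U)` for some `U` with `∅ ≠ U ⊆ T` or `T ⊆ U ⊊ V`. -/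
def IsBicut (D : ArcDigraph V A) (T : Finset V) (C : Finset A) : Prop :=
  ∃ U : Finset V, C = D.deltaIn U ∧
    ((U.Nonempty ∧ U ⊆ T) ∨ (T ⊆ U ∧ U ≠ Finset.univ))

instance (D : ArcDigraph V A) (T : Finset V) : DecidablePred (D.IsBicut T) := fun C =>
  inferInstanceAs (Decidable (∃ U : Finset V, C = D.deltaIn U ∧
    ((U.Nonempty ∧ U ⊆ T) ∨ (T ⊆ U ∧ U ≠ Finset.univ))))

/-- The index set of the inequalities: one for each `v ∈ T`, each `v ∈ S`, each bicut, each arc. -/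
abbrev Row (D : ArcDigraph V A) (S T : Finset V) : Type _ :=
  {v : V // v ∈ T} ⊕ {v : V // v ∈ S} ⊕ {C : Finset A // D.IsBicut T C} ⊕ A

/-- The set of arcs on which the inequality has coefficient one (it is zero on the others). -/
def rowArcs (D : ArcDigraph V A) (S T : Finset V) : D.Row S T → Finset A
  | .inl v => D.deltaIn {v.1}
  | .inr (.inl v) => D.deltaOut {v.1}
  | .inr (.inr (.inl C)) => C.1
  | .inr (.inr (.inr a)) => {a}

/-- The coefficient matrix of the system `x(δ⁻(v)) ≥ b(v)` for `v ∈ T`, `x(δ⁺(v)) ≥ b(v)` for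
`v ∈ S`, `x(C) ≥ 1` for each bicut `C`, `x(a) ≥ 0` for each arc `a`. -/
def bibranchingMatrix (D : ArcDigraph V A) (S T : Finset V) : Matrix (D.Row S T) A ℝ :=
  Matrix.of fun i a => if a ∈ D.rowArcs S T i then 1 else 0

/-- The right-hand side of the same system. -/
def bibranchingRhs (D : ArcDigraph V A) (S T : Finset V) (b : V → ℤ) : D.Row S T → ℝ
  | .inl v => b v.1
  | .inr (.inl v) => b v.1
  | .inr (.inr (.inl _)) => 1
  | .inr (.inr (.inr _)) => 0

end ArcDigraph

/-! A bicut is either δ⁻(U) with U ⊆ T, or δ⁺(U) with U ⊆ S (complement the set). So all rows except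
x ≥ 0 are indexed by subsets of T or of S, with a demand that is b(v) on singletons and 1 on larger
sets; on each side it is supermodular on properly intersecting pairs (`demand_supermodular`).
Nonnegativity merges with the box into the lower bound max(l, 0).

Uncrossing gives an optimal real dual solution y whose support is laminar on each side
(`exists_uncrossed_optimum`). It is rounded directly: for Φ(X), the sum of y over the supersets of X
on its side, y(U) is an increment of Φ, and it is replaced by the increment of a shifted rounding of
Φ. Along the chain of support sets containing X these increments telescope, so the load of each arc
also becomes a difference of two floors with the same shift (`exists_integral_of_laminar`). A
uniformly random shift preserves every such difference in expectation, so some shift does not lower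
the objective (`exists_shift_sum_floor_ge`). -/

/-! ### Attainment of linear programming optima. -/

open Finset in
/-- A nonnegative solution of `f z = w` can be moved to one whose support carries no kernel vector
of `f`, without decreasing an objective that is bounded above. -/
theorem exists_basic_solution {ι E : Type*} [Fintype ι] [AddCommGroup E] [Module ℝ E]
    (f : (ι → ℝ) →ₗ[ℝ] E) (c : (ι → ℝ) →ₗ[ℝ] ℝ) (w : E) (B : ℝ)
    (hB : ∀ z : ι → ℝ, 0 ≤ z → f z = w → c z ≤ B) (k : ℕ) :
    ∀ z : ι → ℝ, 0 ≤ z → f z = w → #{i | z i ≠ 0} = k →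
      ∃ y : ι → ℝ, (0 ≤ y ∧ f y = w ∧ ∀ d : ι → ℝ, (∀ i, y i = 0 → d i = 0) → f d = 0 → d = 0) ∧
        c z ≤ c y := by
  induction k using Nat.strong_induction_on with
  | _ k ih =>
    intro z hz hfz hk
    by_cases hred : ∀ d : ι → ℝ, (∀ i, z i = 0 → d i = 0) → f d = 0 → d = 0
    · exact ⟨z, ⟨hz, hfz, hred⟩, le_rfl⟩
    push Not at hred
    obtain ⟨d₀, hd₀, hf₀, hne⟩ := hred
    obtain ⟨d, hd, hfd, hcd, hneg⟩ : ∃ d : ι → ℝ, (∀ i, z i = 0 → d i = 0) ∧ f d = 0 ∧ 0 ≤ c d ∧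
        ∃ i, d i < 0 := by
      -- An improving kernel direction must have a negative coordinate, or following it far enough
      -- would push the objective past `B`.
      have key : ∀ d : ι → ℝ, (∀ i, z i = 0 → d i = 0) → f d = 0 → 0 < c d → ∃ i, d i < 0 := by
        intro d _ hfd hcd
        by_contra! hnn
        have h1 : 0 ≤ (|B - c z| + 1) / c d := by positivity
        have := hB (z + ((|B - c z| + 1) / c d) • d)
          (add_nonneg hz (smul_nonneg h1 hnn)) (by simp [hfz, hfd])
        rw [map_add, map_smul, smul_eq_mul, div_mul_cancel₀ _ hcd.ne'] at this
        linarith [le_abs_self (B - c z)]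
      have hd₀' : ∀ i, z i = 0 → (-d₀) i = 0 := fun i hi => by simp [hd₀ i hi]
      have hf₀' : f (-d₀) = 0 := by simp [hf₀]
      rcases lt_trichotomy (c d₀) 0 with h | h | h
      · have h' : 0 < c (-d₀) := by simpa using h
        exact ⟨-d₀, hd₀', hf₀', h'.le, key _ hd₀' hf₀' h'⟩
      · obtain ⟨i, hi⟩ := Function.ne_iff.mp hne
        rcases lt_or_gt_of_ne hi with hi | hi
        · exact ⟨d₀, hd₀, hf₀, h.ge, i, hi⟩
        · exact ⟨-d₀, hd₀', hf₀', by simp [h], i, by simpa using hi⟩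
      · exact ⟨d₀, hd₀, hf₀, h.le, key _ hd₀ hf₀ h⟩
    obtain ⟨j, hj, hmin⟩ := exists_min_image ({i | d i < 0} : Finset ι) (fun i => z i / (-d i))
      (by obtain ⟨i, hi⟩ := hneg; exact ⟨i, by simpa using hi⟩)
    simp only [mem_filter, mem_univ, true_and] at hj hmin
    -- The longest step along `d` that stays nonnegative; coordinate `j` becomes zero and the
    -- support shrinks.
    set t := z j / (-d j) with ht
    have ht0 : 0 ≤ t := div_nonneg (hz j) (by linarith)
    have hz' : 0 ≤ z + t • d := by
      intro i
      rcases lt_or_ge (d i) 0 with h | h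
      · have := hmin i h
        rw [le_div_iff₀ (by linarith)] at this
        simp only [Pi.zero_apply, Pi.add_apply, Pi.smul_apply, smul_eq_mul]
        linarith
      · exact add_nonneg (hz i) (mul_nonneg ht0 h)
    have hlt : #{i | (z + t • d) i ≠ 0} < k := by
      rw [← hk]
      apply card_lt_card
      refine ⟨fun i => ?_, fun h => ?_⟩
      · simp only [mem_filter, mem_univ, true_and]
        intro h h0
        exact h (by simp [h0, hd i h0])
      · have h1 : z j ≠ 0 := fun h0 => by simp [hd j h0] at hj
        have h2 := h (show j ∈ _ by simpa using h1)
        simp only [mem_filter, mem_univ, true_and] at h2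
        apply h2
        have : d j ≠ 0 := hj.ne
        simp only [Pi.add_apply, Pi.smul_apply, smul_eq_mul, ht]
        field_simp
        ring
    obtain ⟨y, hy, hcy⟩ := ih _ hlt (z + t • d) hz' (by simp [hfz, hfd]) rfl
    refine ⟨y, hy, le_trans ?_ hcy⟩
    simpa using mul_nonneg ht0 hcd

/-- A linear objective that is bounded above on `{z ≥ 0 : f z = w}` attains its maximum. -/
theorem exists_max_of_bounded {ι E : Type*} [Fintype ι] [AddCommGroup E] [Module ℝ E]
    (f : (ι → ℝ) →ₗ[ℝ] E) (c : (ι → ℝ) →ₗ[ℝ] ℝ) (w : E) (B : ℝ)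
    (hB : ∀ z : ι → ℝ, 0 ≤ z → f z = w → c z ≤ B) (hne : ∃ z : ι → ℝ, 0 ≤ z ∧ f z = w) :
    ∃ y : ι → ℝ, 0 ≤ y ∧ f y = w ∧ ∀ z : ι → ℝ, 0 ≤ z → f z = w → c z ≤ c y := by
  set P : Set (ι → ℝ) := {y | 0 ≤ y ∧ f y = w ∧
    ∀ d : ι → ℝ, (∀ i, y i = 0 → d i = 0) → f d = 0 → d = 0}
  -- Two basic solutions with the same zero set differ by a kernel vector on their support, so they
  -- coincide: there are at most as many as zero sets.
  have hfin : P.Finite := by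
    refine Set.Finite.of_finite_image (f := fun y : ι → ℝ => {i | y i = 0}) (Set.toFinite _) ?_
    rintro y ⟨_, hfy, hy⟩ z ⟨_, hfz, _⟩ hyz
    refine sub_eq_zero.mp (hy (y - z) (fun i hi => ?_) (by simp [hfy, hfz]))
    have h : z i = 0 := (Set.ext_iff.mp hyz i).mp hi
    simp [h, show y i = 0 from hi]
  obtain ⟨z, hz, hfz⟩ := hne
  obtain ⟨y₀, hy₀, -⟩ := exists_basic_solution f c w B hB _ z hz hfz rfl
  obtain ⟨y, hy, hmax⟩ := Set.exists_max_image P c hfin ⟨y₀, hy₀⟩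
  refine ⟨y, hy.1, hy.2.1, fun z hz hfz => ?_⟩
  obtain ⟨y₁, hy₁, h⟩ := exists_basic_solution f c w B hB _ z hz hfz rfl
  exact h.trans (hmax y₁ hy₁)

/-! ### Random-shift rounding and telescoping over laminar families. -/

/-- Some common shift makes simultaneous rounding down at least as good as the average. -/
theorem exists_shift_sum_floor_ge {ι : Type*} [Fintype ι] (c P Q : ι → ℝ) :
    ∃ θ : ℝ, ∑ i, c i * (P i - Q i) ≤ ∑ i, c i * ((⌊P i + θ⌋ : ℝ) - ⌊Q i + θ⌋) := by
  have hfr : ∀ a b : ℝ, IntervalIntegrable (fun t : ℝ => Int.fract t) MeasureTheory.volume a b := by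
    intro a b
    rw [intervalIntegrable_iff]
    refine MeasureTheory.Measure.integrableOn_of_bounded (M := 1) ?_
      measurable_fract.aestronglyMeasurable (Filter.Eventually.of_forall fun t => ?_)
    · simp
    · rw [Real.norm_eq_abs, abs_of_nonneg (Int.fract_nonneg t)]
      exact (Int.fract_lt_one t).le
  have hint : ∀ x : ℝ, IntervalIntegrable (fun θ : ℝ => Int.fract (x + θ))
      MeasureTheory.volume 0 1 := fun x => by
    simpa using (hfr (x + 0) (x + 1)).comp_add_left x
  have hval : ∀ x : ℝ, ∫ θ in (0 : ℝ)..1, Int.fract (x + θ) = ∫ θ in (0 : ℝ)..1, Int.fract θ := by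
    intro x
    rw [intervalIntegral.integral_comp_add_left (fun t => Int.fract t) x]
    have h : Function.Periodic (fun t : ℝ => Int.fract t) 1 := fun t => Int.fract_add_one t
    simpa using h.intervalIntegral_add_eq x 0
  -- `g θ` is the gain of rounding with shift θ over the exact value. Its mean over a period is
  -- zero, so it is nonnegative somewhere.
  set g : ℝ → ℝ := fun θ => ∑ i, c i * (Int.fract (Q i + θ) - Int.fract (P i + θ))
  have hgi : IntervalIntegrable g MeasureTheory.volume 0 1 := by
    have h : g = ∑ i, fun θ => c i * (Int.fract (Q i + θ) - Int.fract (P i + θ)) := by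
      ext θ
      simp [g]
    rw [h]
    exact IntervalIntegrable.sum _ fun i _ => ((hint (Q i)).sub (hint (P i))).const_mul (c i)
  have hg : ∫ θ in (0 : ℝ)..1, g θ = 0 := by
    rw [intervalIntegral.integral_finsetSum fun i _ => ((hint _).sub (hint _)).const_mul _]
    refine Finset.sum_eq_zero fun i _ => ?_
    rw [intervalIntegral.integral_const_mul, intervalIntegral.integral_sub (hint _) (hint _),
      hval, hval, sub_self, mul_zero]
  obtain ⟨θ, hθ⟩ : ∃ θ, 0 ≤ g θ := by
    by_contra! hneg
    have := intervalIntegral.integral_pos_iff_support_of_nonneg_ae (f := fun θ => -g θ)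
      (μ := MeasureTheory.volume) (a := 0) (b := 1)
      (Filter.Eventually.of_forall fun θ => by simpa using (hneg θ).le) hgi.neg
    rw [intervalIntegral.integral_neg, hg] at this
    have hs : Function.support (fun θ => -g θ) = Set.univ :=
      Set.eq_univ_of_forall fun θ => by simpa using (hneg θ).ne
    simp [hs] at this
  refine ⟨θ, sub_nonneg.mp (hθ.trans_eq ?_)⟩
  rw [← Finset.sum_sub_distrib]
  refine Finset.sum_congr rfl fun i _ => ?_
  simp only [Int.fract]
  ring

open Finset in
/-- Telescoping along a chain of sets. -/
theorem sum_chain_telescope {V : Type*} [DecidableEq V] (y : Finset V → ℝ) (f : ℝ → ℤ) (n : ℕ) :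
    ∀ C : Finset (Finset V), #C = n → (∀ X ∈ C, ∀ Y ∈ C, X ⊆ Y ∨ Y ⊆ X) →
      ∑ W ∈ C, (f (∑ U ∈ C with W ⊆ U, y U) - f (∑ U ∈ C with W ⊆ U, y U - y W)) =
        f (∑ U ∈ C, y U) - f 0 := by
  induction n with
  | zero =>
    intro C hC _
    rw [card_eq_zero.mp hC]; simp
  | succ n ih =>
    intro C hC hchain
    have hne : C.Nonempty := card_pos.mp (by omega)
    -- The least member `X` contributes `f` of the total minus `f` of the total without `y X`, and
    -- the latter is where the rest of the chain starts.
    obtain ⟨X, hX, hmin⟩ := exists_min_image C card hne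
    have hXle : ∀ W ∈ C, X ⊆ W := by
      intro W hW
      rcases hchain X hX W hW with h | h
      · exact h
      · rw [eq_of_subset_of_card_le h (hmin W hW)]
    have hrec := ih (C.erase X) (by rw [card_erase_of_mem hX]; omega)
      fun Y hY Z hZ => hchain Y (mem_of_mem_erase hY) Z (mem_of_mem_erase hZ)
    have hfilter : ∀ W ∈ C.erase X, ({U ∈ C | W ⊆ U} : Finset _) = {U ∈ C.erase X | W ⊆ U} := by
      intro W hW
      ext U
      simp only [mem_filter, mem_erase]
      refine ⟨fun h => ⟨⟨fun hU => ?_, h.1⟩, h.2⟩, fun h => ⟨h.1.2, h.2⟩⟩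
      exact (ne_of_mem_erase hW) (subset_antisymm (hU ▸ h.2) (hXle W (mem_of_mem_erase hW)))
    have hrest : ∑ W ∈ C.erase X, (f (∑ U ∈ C with W ⊆ U, y U) -
        f (∑ U ∈ C with W ⊆ U, y U - y W)) = f (∑ U ∈ C.erase X, y U) - f 0 := by
      rw [← hrec]
      exact sum_congr rfl fun W hW => by rw [hfilter W hW]
    rw [← add_sum_erase C _ hX, hrest, filter_true_of_mem hXle, ← add_sum_erase C y hX,
      add_sub_cancel_left]
    ring

open Finset in
/-- If the support of `y` is laminar inside `R`, the increments of `f` along the sums of `y` over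
supersets telescope. -/
theorem sum_laminar_telescope {V : Type*} [DecidableEq V] (R : Finset V)
    (y : Finset V → ℝ) (f : ℝ → ℤ)
    (hlam : ∀ X Y, X ⊆ R → Y ⊆ R → y X ≠ 0 → y Y ≠ 0 → (X ∩ Y).Nonempty → X ⊆ Y ∨ Y ⊆ X)
    (X : Finset V) (hX : X.Nonempty) :
    ∑ W ∈ R.powerset with X ⊆ W, (f (∑ U ∈ R.powerset with W ⊆ U, y U) -
        f (∑ U ∈ R.powerset with W ⊆ U, y U - y W)) =
      f (∑ U ∈ R.powerset with X ⊆ U, y U) - f 0 := by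
  -- Support sets containing the nonempty `X` meet pairwise, so laminarity makes them a chain; sets
  -- off the support have zero increment.
  set C : Finset (Finset V) := {W ∈ R.powerset | X ⊆ W ∧ y W ≠ 0} with hC
  have hsum : ∀ W, X ⊆ W → ∑ U ∈ R.powerset with W ⊆ U, y U = ∑ U ∈ C with W ⊆ U, y U := by
    intro W hW
    symm
    apply sum_subset
    · intro U
      simp only [hC, mem_filter]
      tauto
    · intro U hU hU'
      simp only [hC, mem_filter, mem_powerset, not_and] at hU hU'
      by_contra h
      exact hU' ⟨hU.1, hW.trans hU.2, h⟩ hU.2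
  have htel := sum_chain_telescope y f #C C rfl fun Y hY Z hZ => by
    simp only [hC, mem_filter, mem_powerset] at hY hZ
    exact hlam Y Z hY.1 hZ.1 hY.2.2 hZ.2.2 (hX.mono (subset_inter hY.2.1 hZ.2.1))
  rw [hsum X subset_rfl, filter_true_of_mem (s := C) (p := fun U => X ⊆ U) fun U hU => by
    simp only [hC, mem_filter] at hU; exact hU.2.1, ← htel]
  symm
  apply sum_subset_zero_on_sdiff
  · intro U
    simp only [hC, mem_filter]
    tauto
  · intro W hW
    simp only [hC, mem_sdiff, mem_filter, not_and, not_not] at hW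
    rw [hW.2 hW.1.1 hW.1.2]; simp
  · intro W hW
    simp only [hC, mem_filter] at hW
    rw [hsum W hW.2.1]

/-! ### Uncrossing an optimal dual solution. -/

open Finset in
/-- A packing program over sets with bounded objective has an optimal solution whose support
contains no two properly crossing sets that can be uncrossed. -/
theorem exists_uncrossed_optimum {V A : Type*} [Fintype V] [DecidableEq V] [Fintype A]
    (N : Finset V → A → ℝ) (p : Finset V → ℝ) (m u w : A → ℝ) (hm : 0 ≤ m) (B : ℝ)
    (hB : ∀ (y : Finset V → ℝ) (s t : A → ℝ), 0 ≤ y → 0 ≤ s → 0 ≤ t →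
      (∀ a, ∑ U, y U * N U a + s a - t a = w a) →
      ∑ U, y U * p U + ∑ a, s a * m a - ∑ a, t a * u a ≤ B) :
    ∃ (y : Finset V → ℝ) (s t : A → ℝ), 0 ≤ y ∧ 0 ≤ s ∧ 0 ≤ t ∧
      (∀ a, ∑ U, y U * N U a + s a - t a = w a) ∧
      (∀ (y' : Finset V → ℝ) (s' t' : A → ℝ), 0 ≤ y' → 0 ≤ s' → 0 ≤ t' →
        (∀ a, ∑ U, y' U * N U a + s' a - t' a = w a) →
        ∑ U, y' U * p U + ∑ a, s' a * m a - ∑ a, t' a * u a ≤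
          ∑ U, y U * p U + ∑ a, s a * m a - ∑ a, t a * u a) ∧
      ∀ X Y, y X ≠ 0 → y Y ≠ 0 →
        (∀ a, N (X ∩ Y) a + N (X ∪ Y) a ≤ N X a + N Y a) →
        p X + p Y ≤ p (X ∩ Y) + p (X ∪ Y) → X ⊆ Y ∨ Y ⊆ X := by
  let f : (Finset V ⊕ A ⊕ A → ℝ) →ₗ[ℝ] (A → ℝ) :=
    { toFun := fun z a => ∑ U, z (.inl U) * N U a + z (.inr (.inl a)) - z (.inr (.inr a))
      map_add' := fun z z' => by
        ext a; simp only [Pi.add_apply, add_mul, sum_add_distrib]; ring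
      map_smul' := fun r z => by
        ext a
        simp only [Pi.smul_apply, smul_eq_mul, RingHom.id_apply, mul_assoc, ← mul_sum]; ring }
  let c : (Finset V ⊕ A ⊕ A → ℝ) →ₗ[ℝ] ℝ :=
    { toFun := fun z => ∑ U, z (.inl U) * p U + ∑ a, z (.inr (.inl a)) * m a -
        ∑ a, z (.inr (.inr a)) * u a
      map_add' := fun z z' => by
        simp only [Pi.add_apply, add_mul, sum_add_distrib]; ring
      map_smul' := fun r z => by
        simp only [Pi.smul_apply, smul_eq_mul, RingHom.id_apply, mul_assoc, ← mul_sum]; ring }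
  -- A secondary objective, strictly convex in the cardinality so that uncrossing increases it
  -- strictly; the constant makes it nonpositive, hence bounded above.
  let q : Finset V → ℝ := fun U => (#U : ℝ) ^ 2 - (Fintype.card V : ℝ) ^ 2
  let φ : (Finset V ⊕ A ⊕ A → ℝ) →ₗ[ℝ] ℝ :=
    { toFun := fun z => ∑ U, z (.inl U) * q U
      map_add' := fun z z' => by
        simp only [Pi.add_apply, add_mul, sum_add_distrib]
      map_smul' := fun r z => by
        simp only [Pi.smul_apply, smul_eq_mul, RingHom.id_apply, mul_assoc, ← mul_sum] }
  have hq : ∀ U, q U ≤ 0 := fun U => by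
    have : (#U : ℝ) ≤ Fintype.card V := by exact_mod_cast card_le_univ U
    simp only [q]
    nlinarith [(Nat.cast_nonneg #U : (0 : ℝ) ≤ #U)]
  obtain ⟨z₀, hz₀, hfz₀, hopt₀⟩ := exists_max_of_bounded f c w B
    (fun z hz hfz => hB (fun U => z (.inl U)) (fun a => z (.inr (.inl a)))
      (fun a => z (.inr (.inr a))) (fun _ => hz _) (fun _ => hz _) (fun _ => hz _)
      (fun a => congrFun hfz a))
    ⟨Sum.elim 0 (Sum.elim (fun a => max (w a) 0) fun a => max (-w a) 0), by
      rintro (U | a | a) <;> simp, by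
      ext a
      rcases le_total (w a) 0 with h | h <;> simp [f, h]⟩
  -- Maximize `φ` over the optimal face, cut out by the extra equation `c z = c z₀`.
  obtain ⟨z, hz, hfz, hopt⟩ := exists_max_of_bounded (f.prod c) φ (w, c z₀) 0
    (fun z hz _ => sum_nonpos fun U _ => mul_nonpos_of_nonneg_of_nonpos (hz _) (hq U))
    ⟨z₀, hz₀, by simp [hfz₀]⟩
  have hfz1 : f z = w := congrArg Prod.fst hfz
  have hcz : c z = c z₀ := congrArg Prod.snd hfz
  refine ⟨fun U => z (.inl U), fun a => z (.inr (.inl a)), fun a => z (.inr (.inr a)),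
    fun _ => hz _, fun _ => hz _, fun _ => hz _, fun a => congrFun hfz1 a, ?_, ?_⟩
  · intro y' s' t' hy' hs' ht' hf'
    refine le_trans ?_ hcz.ge
    refine hopt₀ (Sum.elim y' (Sum.elim s' t')) ?_ (funext hf')
    rintro (U | a | a)
    exacts [hy' U, hs' a, ht' a]
  · intro X Y hX hY hN hp
    by_contra! hXY
    obtain ⟨h1, h2⟩ := hXY
    have hne : X ≠ Y := fun h => h1 h.subset
    set ε := min (z (.inl X)) (z (.inl Y)) with hε
    have hε0 : 0 < ε := lt_min (lt_of_le_of_ne (hz _) hX.symm) (lt_of_le_of_ne (hz _) hY.symm)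
    let d : Finset V → ℝ := Pi.single (X ∩ Y) 1 + Pi.single (X ∪ Y) 1 - Pi.single X 1 -
      Pi.single Y 1
    have hd : ∀ g : Finset V → ℝ, ∑ U, (z (.inl U) + ε * d U) * g U =
        ∑ U, z (.inl U) * g U + ε * (g (X ∩ Y) + g (X ∪ Y) - g X - g Y) := by
      intro g
      simp only [add_mul, sum_add_distrib, mul_assoc, ← mul_sum]
      congr 2
      simp [d, add_mul, sub_mul, sum_add_distrib, sum_sub_distrib, Pi.single_apply]
    -- Uncrossing may lower the load of an arc; `s` makes up the difference, at no loss because `m ≥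
    -- 0`.
    let e : A → ℝ := fun a => N X a + N Y a - N (X ∩ Y) a - N (X ∪ Y) a
    have he : ∀ a, 0 ≤ e a := fun a => by simp only [e]; linarith [hN a]
    let z' : Finset V ⊕ A ⊕ A → ℝ := Sum.elim (fun U => z (.inl U) + ε * d U)
      (Sum.elim (fun a => z (.inr (.inl a)) + ε * e a) fun a => z (.inr (.inr a)))
    have hz' : 0 ≤ z' := by
      rintro (U | a | a)
      · have a1 : (0 : ℝ) ≤ Pi.single (M := fun _ => ℝ) (X ∩ Y) 1 U := by
          rw [Pi.single_apply]; split_ifs <;> norm_num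
        have a2 : (0 : ℝ) ≤ Pi.single (M := fun _ => ℝ) (X ∪ Y) 1 U := by
          rw [Pi.single_apply]; split_ifs <;> norm_num
        have a3 : 0 ≤ z (.inl U) + ε * (- Pi.single (M := fun _ => ℝ) X 1 U -
            Pi.single (M := fun _ => ℝ) Y 1 U) := by
          by_cases hUX : U = X
          · subst hUX
            simp [hne, hε]
          · by_cases hUY : U = Y
            · subst hUY
              simp [hne.symm, hε]
            · simpa [hUX, hUY] using hz (.inl U)
        have : z' (.inl U) = (z (.inl U) + ε * (- Pi.single (M := fun _ => ℝ) X 1 U -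
            Pi.single (M := fun _ => ℝ) Y 1 U)) + ε * Pi.single (M := fun _ => ℝ) (X ∩ Y) 1 U +
            ε * Pi.single (M := fun _ => ℝ) (X ∪ Y) 1 U := by
          simp only [z', d, Sum.elim_inl, Pi.add_apply, Pi.sub_apply]
          ring
        rw [Pi.zero_apply, this]
        positivity
      · exact add_nonneg (hz _) (mul_nonneg hε0.le (he a))
      · exact hz _
    have hfz' : f z' = w := by
      ext a
      have h := congrFun hfz1 a
      simp only [f, LinearMap.coe_mk, AddHom.coe_mk] at h
      simp only [f, LinearMap.coe_mk, AddHom.coe_mk, z', Sum.elim_inl, Sum.elim_inr]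
      rw [hd fun U => N U a, ← h]
      simp only [e]
      ring
    have hcz' : c z ≤ c z' := by
      simp only [c, LinearMap.coe_mk, AddHom.coe_mk, z', Sum.elim_inl, Sum.elim_inr]
      rw [hd p]
      have h3 : 0 ≤ ε * (p (X ∩ Y) + p (X ∪ Y) - p X - p Y) := mul_nonneg hε0.le (by linarith)
      have h4 : ∑ a, z (.inr (.inl a)) * m a ≤ ∑ a, (z (.inr (.inl a)) + ε * e a) * m a := by
        refine sum_le_sum fun a _ => mul_le_mul_of_nonneg_right ?_ (hm a)
        linarith [mul_nonneg hε0.le (he a)]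
      linarith
    have hfin := hopt z' hz'
      (Prod.ext hfz' ((hopt₀ z' hz' hfz').antisymm (hcz.ge.trans hcz')))
    simp only [φ, LinearMap.coe_mk, AddHom.coe_mk, z', Sum.elim_inl] at hfin
    rw [hd q] at hfin
    have hcard : (#(X ∩ Y) : ℝ) = #X + #Y - #(X ∪ Y) := by
      have := card_inter_add_card_union X Y
      rw [eq_sub_iff_add_eq]
      exact_mod_cast this
    have hX' : (#X : ℝ) < #(X ∪ Y) := by
      exact_mod_cast card_lt_card ⟨subset_union_left, fun h => h2 (subset_union_right.trans h)⟩
    have hY' : (#Y : ℝ) < #(X ∪ Y) := by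
      exact_mod_cast card_lt_card ⟨subset_union_right, fun h => h1 (subset_union_left.trans h)⟩
    have hpos : 0 < q (X ∩ Y) + q (X ∪ Y) - q X - q Y := by
      have : q (X ∩ Y) + q (X ∪ Y) - q X - q Y =
          2 * ((#(X ∪ Y) - #X : ℝ) * (#(X ∪ Y) - #Y)) := by
        simp only [q, hcard]; ring
      rw [this]
      have := mul_pos (sub_pos.mpr hX') (sub_pos.mpr hY')
      positivity
    linarith [mul_pos hε0 hpos]

/-! ### Cuts and demands indexed by vertex sets. -/

namespace ArcDigraph

/-- The arcs entering `U` if `U ⊆ T`, the arcs leaving `U` if `U ⊆ S`. -/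
def cutArcs {V A : Type*} [DecidableEq V] [Fintype A] (D : ArcDigraph V A) (S T U : Finset V) : Finset A :=
  if U ⊆ T then D.deltaIn U else if U ⊆ S then D.deltaOut U else ∅

/-- The lower bound imposed on the arc set `cutArcs D S T U`. -/
def demand {V : Type*} [DecidableEq V] (S T : Finset V) (b : V → ℤ) (U : Finset V) : ℝ :=
  if U.Nonempty ∧ (U ⊆ T ∨ U ⊆ S) then (if U.card = 1 then ((∑ v ∈ U, b v : ℤ) : ℝ) else 1) else 0

/-- Neither of two intersecting, non-nested sets is a singleton, so each has demand at most 1. Their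
intersection and union have demand at least 1; the intersection may be a singleton, where `b ≥ 1`
enters. -/
theorem demand_supermodular {V : Type*} [DecidableEq V] {S T R : Finset V} {b : V → ℤ} (hb : ∀ v, 0 < b v)
    (hR : ∀ U ⊆ R, U ⊆ T ∨ U ⊆ S) {X Y : Finset V} (hX : X ⊆ R) (hY : Y ⊆ R)
    (hXY : (X ∩ Y).Nonempty) (h1 : ¬ X ⊆ Y) (h2 : ¬ Y ⊆ X) :
    demand S T b X + demand S T b Y ≤ demand S T b (X ∩ Y) + demand S T b (X ∪ Y) := by
  have hone : ∀ U ⊆ R, U.Nonempty → 1 ≤ demand S T b U := by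
    intro U hU hne
    rw [demand, if_pos ⟨hne, hR U hU⟩]
    split_ifs with hc
    · obtain ⟨v, rfl⟩ := Finset.card_eq_one.mp hc
      rw [Finset.sum_singleton]
      exact_mod_cast hb v
    · exact le_rfl
  have hle : ∀ U, U.card ≠ 1 → demand S T b U ≤ 1 := by
    intro U hU
    rw [demand, if_neg hU]
    split_ifs <;> norm_num
  have hcard : ∀ P Q : Finset V, (P ∩ Q).Nonempty → ¬ P ⊆ Q → P.card ≠ 1 := by
    intro P Q hne h hc
    obtain ⟨v, rfl⟩ := Finset.card_eq_one.mp hc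
    obtain ⟨x, hx⟩ := hne
    rw [Finset.mem_inter, Finset.mem_singleton] at hx
    exact h (by rw [Finset.singleton_subset_iff, ← hx.1]; exact hx.2)
  have := hone _ (Finset.inter_subset_left.trans hX) hXY
  have := hone _ (Finset.union_subset hX hY) (hXY.mono
    (Finset.inter_subset_left.trans Finset.subset_union_left))
  have := hle X (hcard X Y hXY h1)
  have := hle Y (hcard Y X (by rwa [Finset.inter_comm]) h2)
  linarith

theorem cutArcs_of_subset_left {V A : Type*} [DecidableEq V] [Fintype A] {S T U : Finset V}
    (D : ArcDigraph V A) (hST : Disjoint S T)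
    (hU : U.Nonempty) (h : U ⊆ S) : D.cutArcs S T U = D.deltaOut U := by
  rw [cutArcs, if_neg, if_pos h]
  intro hT
  obtain ⟨x, hx⟩ := hU
  exact Finset.disjoint_left.mp hST (h hx) (hT hx)

theorem deltaIn_submodular {V A : Type*} [DecidableEq V] [Fintype A] [DecidableEq A]
    (D : ArcDigraph V A) (X Y : Finset V) (a : A) :
    (if a ∈ D.deltaIn (X ∩ Y) then (1 : ℝ) else 0) + (if a ∈ D.deltaIn (X ∪ Y) then 1 else 0) ≤
      (if a ∈ D.deltaIn X then 1 else 0) + (if a ∈ D.deltaIn Y then 1 else 0) := by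
  simp only [deltaIn, Finset.mem_filter, Finset.mem_univ, true_and, Finset.mem_inter,
    Finset.mem_union]
  by_cases h1 : D.tail a ∈ X <;> by_cases h2 : D.tail a ∈ Y <;>
    by_cases h3 : D.head a ∈ X <;> by_cases h4 : D.head a ∈ Y <;> simp [h1, h2, h3, h4]

theorem deltaOut_submodular {V A : Type*} [DecidableEq V] [Fintype A] [DecidableEq A]
    (D : ArcDigraph V A) (X Y : Finset V) (a : A) :
    (if a ∈ D.deltaOut (X ∩ Y) then (1 : ℝ) else 0) + (if a ∈ D.deltaOut (X ∪ Y) then 1 else 0) ≤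
      (if a ∈ D.deltaOut X then 1 else 0) + (if a ∈ D.deltaOut Y then 1 else 0) := by
  simp only [deltaOut, Finset.mem_filter, Finset.mem_univ, true_and, Finset.mem_inter,
    Finset.mem_union]
  by_cases h1 : D.tail a ∈ X <;> by_cases h2 : D.tail a ∈ Y <;>
    by_cases h3 : D.head a ∈ X <;> by_cases h4 : D.head a ∈ Y <;> simp [h1, h2, h3, h4]

open Finset in
theorem sum_mul_cutArcs {V A : Type*} [Fintype V] [DecidableEq V] [Fintype A] [DecidableEq A]
    (D : ArcDigraph V A) {S T : Finset V} (hST : Disjoint S T)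
    (g : Finset V → ℝ) (a : A) :
    ∑ U, g U * (if a ∈ D.cutArcs S T U then 1 else 0) =
      ∑ U ∈ T.powerset with D.head a ∈ U ∧ D.tail a ∉ U, g U +
        ∑ U ∈ S.powerset with D.tail a ∈ U ∧ D.head a ∉ U, g U := by
  have hpow : ∀ (R : Finset V) (p : Finset V → Prop) [DecidablePred p],
      ∑ U ∈ R.powerset with p U, g U = ∑ U, if U ⊆ R ∧ p U then g U else 0 := by
    intro R p _
    rw [← sum_filter]
    congr 1
    ext U
    simp
  rw [hpow, hpow, ← sum_add_distrib]
  refine sum_congr rfl fun U _ => ?_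
  by_cases hT : U ⊆ T
  · by_cases hS : U ⊆ S
    · have : U = ∅ := by
        rw [← subset_empty, ← disjoint_iff_inter_eq_empty.mp hST]
        exact subset_inter hS hT
      subst this
      simp [cutArcs, deltaIn]
    · simp [cutArcs, hT, hS, deltaIn, and_comm]
  · by_cases hS : U ⊆ S <;> simp [cutArcs, hT, hS, deltaOut]

-- Expresses the load of an arc through sums over supersets, the quantities that
-- `sum_laminar_telescope` evaluates after rounding.
open Finset in
theorem sum_separating {V M : Type*} [DecidableEq V] [AddCommGroup M]
    (R : Finset V) (g : Finset V → M) (h t : V) :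
    ∑ U ∈ R.powerset with h ∈ U ∧ t ∉ U, g U =
      ∑ U ∈ R.powerset with {h} ⊆ U, g U - ∑ U ∈ R.powerset with {h, t} ⊆ U, g U := by
  rw [eq_sub_iff_add_eq, ← sum_union]
  · congr 1
    ext U
    simp only [mem_union, mem_filter, insert_subset_iff, singleton_subset_iff]
    tauto
  · rw [disjoint_left]
    intro U
    simp only [mem_filter, insert_subset_iff, singleton_subset_iff]
    tauto

/-! ### Rounding a laminar dual solution. -/

open Finset in
/-- A fractional solution with laminar support on both sides can be rounded to an integral one
without decreasing the objective. -/
theorem exists_integral_of_laminar {V A : Type*} [Fintype V] [DecidableEq V] [Fintype A] [DecidableEq A]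
    (D : ArcDigraph V A) {S T : Finset V} (hST : IsCompl S T)
    (p : Finset V → ℝ) (hp : ∀ U, ¬ U ⊆ T → ¬ U ⊆ S → p U = 0) (m u : A → ℝ) (hmu : m ≤ u)
    (w : A → ℤ) (y : Finset V → ℝ) (s t : A → ℝ) (hy : 0 ≤ y) (hs : 0 ≤ s) (ht : 0 ≤ t)
    (hw : ∀ a, ∑ U, y U * (if a ∈ D.cutArcs S T U then 1 else 0) + s a - t a = w a)
    (hlamT : ∀ X Y, X ⊆ T → Y ⊆ T → y X ≠ 0 → y Y ≠ 0 → (X ∩ Y).Nonempty → X ⊆ Y ∨ Y ⊆ X)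
    (hlamS : ∀ X Y, X ⊆ S → Y ⊆ S → y X ≠ 0 → y Y ≠ 0 → (X ∩ Y).Nonempty → X ⊆ Y ∨ Y ⊆ X) :
    ∃ (y' : Finset V → ℤ) (σ : A → ℤ), (∀ U, 0 ≤ y' U) ∧
      (∀ a, ∑ U, (y' U : ℝ) * (if a ∈ D.cutArcs S T U then 1 else 0) + σ a = w a) ∧
      ∑ U, y U * p U + ∑ a, s a * m a - ∑ a, t a * u a ≤
        ∑ U, (y' U : ℝ) * p U + ∑ a, ((max (σ a) 0 : ℤ) : ℝ) * m a -
          ∑ a, ((max (-σ a) 0 : ℤ) : ℝ) * u a := by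
  have hdisj : Disjoint S T := hST.disjoint
  have hcov : ∀ v, v ∈ S ∨ v ∈ T := fun v => by
    have h : S ∪ T = univ := hST.sup_eq_top
    simpa using h.ge (mem_univ v)
  set Φ : Finset V → Finset V → ℝ := fun R X => ∑ U ∈ R.powerset with X ⊆ U, y U with hΦ
  have hΦ0 : ∀ R X, ¬ X ⊆ R → Φ R X = 0 := by
    intro R X h
    refine sum_eq_zero fun U hU => ?_
    simp only [mem_filter, mem_powerset] at hU
    exact absurd (hU.2.trans hU.1) h
  -- The two sides round in mirrored ways, so that `fT θ 0 + fS θ 0 = 0`. For an arc from S to T the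
  -- base terms of the two telescopes then cancel.
  let fT : ℝ → ℝ → ℤ := fun θ x => ⌊x + θ⌋
  let fS : ℝ → ℝ → ℤ := fun θ x => -⌊-x + θ⌋
  let y' : ℝ → Finset V → ℤ := fun θ U =>
    if U ⊆ T then fT θ (Φ T U) - fT θ (Φ T U - y U)
    else if U ⊆ S then fS θ (Φ S U) - fS θ (Φ S U - y U) else 0
  -- The factor `p U` is needed: a set inside neither side may have `y U ≠ 0`, but is rounded to 0
  -- and has `p U = 0`.
  have hset : ∀ U, ∃ P Q : ℝ, p U * y U = p U * (P - Q) ∧ ∀ θ, y' θ U = ⌊P + θ⌋ - ⌊Q + θ⌋ ∧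
      0 ≤ P - Q := by
    intro U
    by_cases hT : U ⊆ T
    · exact ⟨Φ T U, Φ T U - y U, by ring, fun θ => ⟨by simp [y', hT, fT], by simpa using hy U⟩⟩
    · by_cases hS : U ⊆ S
      · refine ⟨-(Φ S U - y U), -Φ S U, by ring, fun θ => ⟨?_, by simpa using hy U⟩⟩
        simp only [y', hT, hS, fS, if_true, if_false]
        ring
      · exact ⟨0, 0, by simp [hp U hT hS], fun θ => ⟨by simp [y', hT, hS], by simp⟩⟩
  have harc : ∀ a, ∃ P Q : ℝ, ∑ U, y U * (if a ∈ D.cutArcs S T U then 1 else 0) = P - Q ∧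
      ∀ θ, ∑ U, (y' θ U : ℝ) * (if a ∈ D.cutArcs S T U then 1 else 0) =
        (⌊P + θ⌋ : ℝ) - ⌊Q + θ⌋ := by
    intro a
    have hreal : ∑ U, y U * (if a ∈ D.cutArcs S T U then 1 else 0) =
        Φ T {D.head a} - Φ T {D.head a, D.tail a} +
          (Φ S {D.tail a} - Φ S {D.tail a, D.head a}) := by
      rw [D.sum_mul_cutArcs hdisj, sum_separating, sum_separating]
    have hT : ∀ θ (X : Finset V), X.Nonempty → ∑ U ∈ T.powerset with X ⊆ U, y' θ U =
        fT θ (Φ T X) - fT θ 0 := by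
      intro θ X hX
      rw [← sum_laminar_telescope T y (fT θ) hlamT X hX]
      refine sum_congr rfl fun U hU => ?_
      simp only [mem_filter, mem_powerset] at hU
      simp [y', hU.1, hΦ]
    have hS : ∀ θ (X : Finset V), X.Nonempty → ∑ U ∈ S.powerset with X ⊆ U, y' θ U =
        fS θ (Φ S X) - fS θ 0 := by
      intro θ X hX
      rw [← sum_laminar_telescope S y (fS θ) hlamS X hX]
      refine sum_congr rfl fun U hU => ?_
      simp only [mem_filter, mem_powerset] at hU
      have hUT : ¬ U ⊆ T := fun h => by
        obtain ⟨x, hx⟩ := hX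
        exact disjoint_left.mp hdisj (hU.1 (hU.2 hx)) (h (hU.2 hx))
      simp [y', hU.1, hUT, hΦ]
    have hint : ∀ θ, ∑ U, (y' θ U : ℝ) * (if a ∈ D.cutArcs S T U then 1 else 0) =
        ((fT θ (Φ T {D.head a}) - fT θ (Φ T {D.head a, D.tail a}) +
          (fS θ (Φ S {D.tail a}) - fS θ (Φ S {D.tail a, D.head a})) : ℤ) : ℝ) := by
      intro θ
      rw [D.sum_mul_cutArcs hdisj, ← Int.cast_sum, ← Int.cast_sum, sum_separating, sum_separating,
        hT _ _ (singleton_nonempty _), hT _ _ (insert_nonempty _ _),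
        hS _ _ (singleton_nonempty _), hS _ _ (insert_nonempty _ _)]
      push_cast
      ring
    have hTS : ∀ v, v ∈ T → v ∉ S := fun v h h' => disjoint_left.mp hdisj h' h
    have hST' : ∀ v, v ∈ S → v ∉ T := fun v h h' => disjoint_left.mp hdisj h h'
    -- An arc inside one side is loaded by that side alone, an arc from T to S by no set, and an arc
    -- from S to T by both sides.
    rcases hcov (D.head a) with hh | hh <;> rcases hcov (D.tail a) with htl | htl
    · refine ⟨-Φ S {D.tail a, D.head a}, -Φ S {D.tail a}, ?_, fun θ => ?_⟩
      · rw [hreal, hΦ0 T {D.head a} (by simp [hST' _ hh]),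
          hΦ0 T {D.head a, D.tail a} (by simp [insert_subset_iff, hST' _ hh])]
        ring
      · rw [hint, hΦ0 T {D.head a} (by simp [hST' _ hh]),
          hΦ0 T {D.head a, D.tail a} (by simp [insert_subset_iff, hST' _ hh])]
        simp only [fS]
        push_cast
        ring
    · refine ⟨0, 0, ?_, fun θ => ?_⟩
      · rw [hreal, hΦ0 T {D.head a} (by simp [hST' _ hh]),
          hΦ0 T {D.head a, D.tail a} (by simp [insert_subset_iff, hST' _ hh]),
          hΦ0 S {D.tail a} (by simp [hTS _ htl]),
          hΦ0 S {D.tail a, D.head a} (by simp [insert_subset_iff, hTS _ htl])]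
        ring
      · rw [hint, hΦ0 T {D.head a} (by simp [hST' _ hh]),
          hΦ0 T {D.head a, D.tail a} (by simp [insert_subset_iff, hST' _ hh]),
          hΦ0 S {D.tail a} (by simp [hTS _ htl]),
          hΦ0 S {D.tail a, D.head a} (by simp [insert_subset_iff, hTS _ htl])]
        push_cast
        ring
    · refine ⟨Φ T {D.head a}, -Φ S {D.tail a}, ?_, fun θ => ?_⟩
      · rw [hreal, hΦ0 T {D.head a, D.tail a} (by simp [insert_subset_iff, hST' _ htl]),
          hΦ0 S {D.tail a, D.head a} (by simp [insert_subset_iff, hTS _ hh])]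
        ring
      · rw [hint, hΦ0 T {D.head a, D.tail a} (by simp [insert_subset_iff, hST' _ htl]),
          hΦ0 S {D.tail a, D.head a} (by simp [insert_subset_iff, hTS _ hh])]
        simp only [fS, fT, neg_zero]
        push_cast
        ring
    · refine ⟨Φ T {D.head a}, Φ T {D.head a, D.tail a}, ?_, fun θ => ?_⟩
      · rw [hreal, hΦ0 S {D.tail a} (by simp [hTS _ htl]),
          hΦ0 S {D.tail a, D.head a} (by simp [insert_subset_iff, hTS _ htl])]
        ring
      · rw [hint, hΦ0 S {D.tail a} (by simp [hTS _ htl]),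
          hΦ0 S {D.tail a, D.head a} (by simp [insert_subset_iff, hTS _ htl])]
        simp only [fT]
        push_cast
        ring
  choose P Q hPQ hy' using hset
  choose P' Q' hPQ' hcut using harc
  -- The price of net slack: `m` for surplus, `u` for deficit. Loads enter the objective with
  -- coefficient `-k`.
  let k : A → ℝ := fun a => if 0 ≤ s a - t a then m a else u a
  obtain ⟨θ, hθ⟩ := exists_shift_sum_floor_ge (Sum.elim p (-k)) (Sum.elim P P') (Sum.elim Q Q')
  simp only [Fintype.sum_sum_type, Sum.elim_inl, Sum.elim_inr, Pi.neg_apply] at hθ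
  let σ : A → ℤ := fun a => w a - (⌊P' a + θ⌋ - ⌊Q' a + θ⌋)
  refine ⟨y' θ, σ, fun U => ?_, fun a => ?_, ?_⟩
  · obtain ⟨h1, h2⟩ := hy' U θ
    rw [h1, sub_nonneg]
    exact Int.floor_mono (by linarith)
  · rw [hcut a θ]
    simp only [σ]
    push_cast
    ring
  have hst : ∀ a, s a - t a = w a - (P' a - Q' a) := fun a => by
    rw [← hPQ' a, ← hw a]; ring
  have hold : ∀ a, s a * m a - t a * u a ≤ (w a - (P' a - Q' a)) * k a := by
    intro a
    rw [← hst a]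
    simp only [k]
    have h1 := mul_nonneg (hs a) (sub_nonneg.mpr (hmu a))
    have h2 := mul_nonneg (ht a) (sub_nonneg.mpr (hmu a))
    split_ifs <;> nlinarith
  -- Since `w a` is an integer, monotonicity of the floor keeps the sign of `s a - t a`, so the
  -- price `k a` stays correct after rounding.
  have hnew : ∀ a, (σ a : ℝ) * k a =
      ((max (σ a) 0 : ℤ) : ℝ) * m a - ((max (-σ a) 0 : ℤ) : ℝ) * u a := by
    intro a
    by_cases h : 0 ≤ s a - t a
    · have hσ : 0 ≤ σ a := by
        have : ⌊P' a + θ⌋ ≤ ⌊Q' a + θ⌋ + w a := by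
          rw [← Int.floor_add_intCast]
          exact Int.floor_mono (by linarith [hst a])
        simp only [σ]; omega
      rw [max_eq_left hσ, max_eq_right (by omega), show k a = m a from if_pos h]
      simp
    · have hσ : σ a ≤ 0 := by
        have : ⌊Q' a + θ⌋ + w a ≤ ⌊P' a + θ⌋ := by
          rw [← Int.floor_add_intCast]
          exact Int.floor_mono (by linarith [hst a])
        simp only [σ]; omega
      rw [max_eq_right hσ, max_eq_left (by omega), show k a = u a from if_neg h]
      simp
  have e1 : ∑ U, y U * p U = ∑ U, p U * (P U - Q U) :=
    sum_congr rfl fun U _ => by rw [← hPQ U, mul_comm]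
  have e2 : ∑ U, (y' θ U : ℝ) * p U = ∑ U, p U * ((⌊P U + θ⌋ : ℝ) - ⌊Q U + θ⌋) :=
    sum_congr rfl fun U _ => by rw [(hy' U θ).1, mul_comm]; push_cast; rfl
  have e3 : ∑ a, s a * m a - ∑ a, t a * u a ≤ ∑ a, w a * k a + ∑ a, -k a * (P' a - Q' a) := by
    rw [← sum_sub_distrib, ← sum_add_distrib]
    refine sum_le_sum fun a _ => (hold a).trans_eq ?_
    ring
  have e4 : ∑ a, ((max (σ a) 0 : ℤ) : ℝ) * m a - ∑ a, ((max (-σ a) 0 : ℤ) : ℝ) * u a =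
      ∑ a, w a * k a + ∑ a, -k a * ((⌊P' a + θ⌋ : ℝ) - ⌊Q' a + θ⌋) := by
    rw [← sum_sub_distrib, ← sum_add_distrib]
    refine sum_congr rfl fun a _ => ?_
    rw [← hnew a]
    simp only [σ]
    push_cast
    ring
  linarith

/-! ### Translation between rows and vertex sets. -/

theorem exists_row_of_set {V A : Type*} [Fintype V] [DecidableEq V] [Fintype A] [DecidableEq A]
    (D : ArcDigraph V A) {S T : Finset V} (hST : IsCompl S T) (b : V → ℤ)
    {U : Finset V} (hU : U.Nonempty) (h : U ⊆ T ∨ U ⊆ S) :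
    ∃ i : D.Row S T, D.rowArcs S T i = D.cutArcs S T U ∧
      D.bibranchingRhs S T b i = demand S T b U := by
  by_cases hc : U.card = 1
  · obtain ⟨v, rfl⟩ := Finset.card_eq_one.mp hc
    rcases h with h | h
    · exact ⟨.inl ⟨v, by simpa using h⟩, by simp [rowArcs, cutArcs, h],
        by simp [bibranchingRhs, demand, h]⟩
    · exact ⟨.inr (.inl ⟨v, by simpa using h⟩),
        by simp [rowArcs, D.cutArcs_of_subset_left hST.disjoint hU h],
        by simp [bibranchingRhs, demand, h]⟩
  · have hdem : demand S T b U = 1 := by rw [demand, if_pos ⟨hU, h⟩, if_neg hc]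
    suffices hbi : D.IsBicut T (D.cutArcs S T U) from
      ⟨.inr (.inr (.inl ⟨_, hbi⟩)), rfl, by rw [hdem]; rfl⟩
    rcases h with h | h
    · exact ⟨U, by rw [cutArcs, if_pos h], .inl ⟨hU, h⟩⟩
    · refine ⟨Uᶜ, ?_, .inr ⟨?_, ?_⟩⟩
      · rw [D.cutArcs_of_subset_left hST.disjoint hU h]
        ext a
        simp [deltaIn, deltaOut]
      · intro v hv
        rw [Finset.mem_compl]
        exact fun hvU => Finset.disjoint_left.mp hST.disjoint (h hvU) hv
      · rw [Ne, Finset.compl_eq_univ_iff]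
        exact hU.ne_empty

/-- Only an inequality holds for right-hand sides, since a bicut row may come from a singleton,
whose demand is `b v`. The row of an arc goes to `∅`, and its unit coefficient is kept as a separate
term, later absorbed into the slack `s`. -/
theorem exists_set_of_row {V A : Type*} [Fintype V] [DecidableEq V] [Fintype A] [DecidableEq A]
    (D : ArcDigraph V A) {S T : Finset V} (hST : IsCompl S T) {b : V → ℤ} (hb : ∀ v, 0 < b v)
    (i : D.Row S T) :
    ∃ U : Finset V, (∀ a, D.bibranchingMatrix S T i a =
        (if a ∈ D.cutArcs S T U then 1 else 0) +
          Sum.elim (fun _ => (0 : ℝ)) (Sum.elim (fun _ => 0) (Sum.elim (fun _ => 0) fun a' => if a = a' then 1 else 0)) i) ∧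
      D.bibranchingRhs S T b i ≤ demand S T b U := by
  have hone : ∀ U : Finset V, U.Nonempty → (U ⊆ T ∨ U ⊆ S) → 1 ≤ demand S T b U := by
    intro U hU h
    rw [demand, if_pos ⟨hU, h⟩]
    split_ifs with hc
    · obtain ⟨v, rfl⟩ := Finset.card_eq_one.mp hc
      rw [Finset.sum_singleton]
      exact_mod_cast hb v
    · exact le_rfl
  rcases i with ⟨v, hv⟩ | ⟨v, hv⟩ | ⟨C, U, rfl, ⟨hU, hUT⟩ | ⟨hTU, hne⟩⟩ | a'
  · exact ⟨{v}, fun a => by simp [bibranchingMatrix, rowArcs, cutArcs, hv]; congr,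
      by simp [bibranchingRhs, demand, hv]⟩
  · have h : {v} ⊆ S := by simpa using hv
    exact ⟨{v}, fun a => by
      simp [bibranchingMatrix, rowArcs,
        D.cutArcs_of_subset_left hST.disjoint (Finset.singleton_nonempty v) h]
      congr,
      by simp [bibranchingRhs, demand, hv]⟩
  · exact ⟨U, fun a => by simp [bibranchingMatrix, rowArcs, cutArcs, hUT]; congr, hone U hU (.inl hUT)⟩
  · have hU : Uᶜ.Nonempty := by
      rw [Finset.nonempty_iff_ne_empty, Ne, Finset.compl_eq_empty_iff]
      exact hne
    have hUS : Uᶜ ⊆ S := by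
      intro v hv
      have h : S ∪ T = Finset.univ := hST.sup_eq_top
      rcases Finset.mem_union.mp (h.ge (Finset.mem_univ v)) with h | h
      · exact h
      · exact absurd (hTU h) (Finset.mem_compl.mp hv)
    refine ⟨Uᶜ, fun a => ?_, hone _ hU (.inr hUS)⟩
    simp [bibranchingMatrix, rowArcs, D.cutArcs_of_subset_left hST.disjoint hU hUS, deltaIn,
      deltaOut]
  · exact ⟨∅, fun a => by simp [bibranchingMatrix, rowArcs, cutArcs, deltaIn],
      by simp [bibranchingRhs, demand]⟩

open Finset in
/-- The reindexed system over subsets of `T` and of `S` satisfies the dual integrality claim. -/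
theorem exists_integral_optimum {V A : Type*} [Fintype V] [DecidableEq V] [Fintype A]
    [DecidableEq A] (D : ArcDigraph V A) {S T : Finset V} (hST : IsCompl S T)
    {b : V → ℤ} (hb : ∀ v, 0 < b v) (m u x : A → ℝ) (hm : 0 ≤ m) (hmx : m ≤ x) (hxu : x ≤ u)
    (hx : ∀ U, demand S T b U ≤ ∑ a, (if a ∈ D.cutArcs S T U then 1 else 0) * x a) (w : A → ℤ) :
    ∃ (y : Finset V → ℤ) (σ : A → ℤ), (∀ U, 0 ≤ y U) ∧
      (∀ a, ∑ U, (y U : ℝ) * (if a ∈ D.cutArcs S T U then 1 else 0) + σ a = w a) ∧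
      ∀ (y' : Finset V → ℝ) (s t : A → ℝ), 0 ≤ y' → 0 ≤ s → 0 ≤ t →
        (∀ a, ∑ U, y' U * (if a ∈ D.cutArcs S T U then 1 else 0) + s a - t a = w a) →
        ∑ U, y' U * demand S T b U + ∑ a, s a * m a - ∑ a, t a * u a ≤
          ∑ U, (y U : ℝ) * demand S T b U + ∑ a, ((max (σ a) 0 : ℤ) : ℝ) * m a -
            ∑ a, ((max (-σ a) 0 : ℤ) : ℝ) * u a := by
  obtain ⟨y, s, t, hy, hs, ht, hw, hopt, hcross⟩ := exists_uncrossed_optimum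
    (fun U a => if a ∈ D.cutArcs S T U then (1 : ℝ) else 0) (demand S T b) m u (fun a => w a) hm
    -- Weak duality: the feasible point `x` bounds every dual value.
    (∑ a, w a * x a) (by
      intro y s t hy hs ht hw
      have h1 : ∑ U, y U * demand S T b U ≤
          ∑ a, (∑ U, y U * (if a ∈ D.cutArcs S T U then 1 else 0)) * x a := by
        refine (sum_le_sum fun U _ => mul_le_mul_of_nonneg_left (hx U) (hy U)).trans_eq ?_
        simp only [sum_mul, mul_sum, mul_assoc]
        exact sum_comm
      have h2 : ∑ a, s a * m a ≤ ∑ a, s a * x a :=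
        sum_le_sum fun a _ => mul_le_mul_of_nonneg_left (hmx a) (hs a)
      have h3 : ∑ a, t a * x a ≤ ∑ a, t a * u a :=
        sum_le_sum fun a _ => mul_le_mul_of_nonneg_left (hxu a) (ht a)
      have h4 : ∑ a, w a * x a = ∑ a, (∑ U, y U * (if a ∈ D.cutArcs S T U then 1 else 0)) * x a +
          ∑ a, s a * x a - ∑ a, t a * x a := by
        rw [← sum_add_distrib, ← sum_sub_distrib]
        refine sum_congr rfl fun a _ => ?_
        rw [← hw a]; ring
      linarith)
  have hlam : ∀ R : Finset V, (∀ U ⊆ R, U ⊆ T ∨ U ⊆ S) →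
      (∀ X Y, X ⊆ R → Y ⊆ R → (X ∩ Y).Nonempty → ∀ a,
        (if a ∈ D.cutArcs S T (X ∩ Y) then (1 : ℝ) else 0) +
            (if a ∈ D.cutArcs S T (X ∪ Y) then 1 else 0) ≤
          (if a ∈ D.cutArcs S T X then 1 else 0) + (if a ∈ D.cutArcs S T Y then 1 else 0)) →
      ∀ X Y, X ⊆ R → Y ⊆ R → y X ≠ 0 → y Y ≠ 0 → (X ∩ Y).Nonempty → X ⊆ Y ∨ Y ⊆ X := by
    intro R hR hsub X Y hX hY hyX hyY hXY
    by_contra! h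
    exact absurd (hcross X Y hyX hyY (hsub X Y hX hY hXY)
      (demand_supermodular hb hR hX hY hXY h.1 h.2)) (by tauto)
  have hlamT := hlam T (fun U h => .inl h) fun X Y hX hY _ a => by
    simp only [cutArcs, hX, hY, union_subset hX hY, inter_subset_left.trans hX, if_true]
    exact D.deltaIn_submodular X Y a
  have hlamS := hlam S (fun U h => .inr h) fun X Y hX hY hXY a => by
    have hXn : X.Nonempty := hXY.mono inter_subset_left
    rw [D.cutArcs_of_subset_left hST.disjoint hXn hX,
      D.cutArcs_of_subset_left hST.disjoint (hXY.mono inter_subset_right) hY,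
      D.cutArcs_of_subset_left hST.disjoint hXY (inter_subset_left.trans hX),
      D.cutArcs_of_subset_left hST.disjoint (hXn.mono subset_union_left) (union_subset hX hY)]
    exact D.deltaOut_submodular X Y a
  obtain ⟨y', σ, hy', hw', hle⟩ := D.exists_integral_of_laminar hST (demand S T b)
    (fun U h1 h2 => by simp [demand, h1, h2]) m u (hmx.trans hxu) w y s t hy hs ht hw hlamT hlamS
  exact ⟨y', σ, hy', hw', fun y₁ s₁ t₁ h1 h2 h3 h4 => (hopt y₁ s₁ t₁ h1 h2 h3 h4).trans hle⟩

end ArcDigraph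

/-! ### Box-total dual integrality. -/

open Finset ArcDigraph in
theorem theorem1 {V A : Type*} [Fintype V] [DecidableEq V] [Fintype A] [DecidableEq A]
    (D : ArcDigraph V A) (S T : Finset V) (hST : IsCompl S T)
    (hS : S.Nonempty) (hT : T.Nonempty) (b : V → ℤ) (hb : ∀ v, 0 < b v) :
    IsBoxTDI (D.bibranchingMatrix S T) (D.bibranchingRhs S T b) := by
  classical
  rintro l u w ⟨x, hx⟩ -
  have hxM : ∀ i, D.bibranchingRhs S T b i ≤ ∑ a, D.bibranchingMatrix S T i a * x a :=
    fun i => hx (.inl i)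
  have hlx : ∀ a, l a ≤ x a := fun a => by simpa [Matrix.one_apply] using hx (.inr (.inl a))
  have hxu : ∀ a, x a ≤ u a := fun a => by simpa [Matrix.one_apply] using hx (.inr (.inr a))
  have hx0 : ∀ a, 0 ≤ x a := fun a => by
    simpa [bibranchingRhs, bibranchingMatrix, rowArcs] using hxM (.inr (.inr (.inr a)))
  have hrow : ∀ U : Finset V, ∃ i : D.Row S T, U.Nonempty ∧ (U ⊆ T ∨ U ⊆ S) →
      D.rowArcs S T i = D.cutArcs S T U ∧ D.bibranchingRhs S T b i = demand S T b U := by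
    intro U
    by_cases h : U.Nonempty ∧ (U ⊆ T ∨ U ⊆ S)
    · obtain ⟨i, hi⟩ := D.exists_row_of_set hST b h.1 h.2
      exact ⟨i, fun _ => hi⟩
    -- An arbitrary row, harmless because `y₀` vanishes on such sets.
    · exact ⟨.inl ⟨_, hT.choose_spec⟩, fun h' => absurd h' h⟩
  choose ρ hρ using hrow
  choose τ hτM hτr using D.exists_set_of_row hST hb
  have hxU : ∀ U, demand S T b U ≤ ∑ a, (if a ∈ D.cutArcs S T U then 1 else 0) * x a := by
    intro U
    by_cases h : U.Nonempty ∧ (U ⊆ T ∨ U ⊆ S)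
    · rw [← (hρ U h).2, ← (hρ U h).1]
      exact hxM (ρ U)
    · rw [demand, if_neg h]
      exact sum_nonneg fun a _ => mul_nonneg (by split_ifs <;> norm_num) (hx0 a)
  obtain ⟨y, σ, hy, hw, hopt⟩ := D.exists_integral_optimum hST hb (fun a => max (l a) 0) u x
    (fun a => le_max_right _ _) (fun a => max_le (hlx a) (hx0 a)) hxu hxU w
  let y₀ : Finset V → ℤ := fun U => if U.Nonempty ∧ (U ⊆ T ∨ U ⊆ S) then y U else 0
  -- The multiplier of the merged bound max(l, 0) goes to the row x(a) ≥ 0 when `l a < 0`, and to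
  -- x(a) ≥ l(a) otherwise.
  let e : D.Row S T → ℤ :=
    Sum.elim 0 (Sum.elim 0 (Sum.elim 0 fun a => if 0 ≤ l a then 0 else max (σ a) 0))
  have he : ∀ i, 0 ≤ e i := by
    rintro (i | i | i | a)
    iterate 3 exact le_rfl
    simp only [e, Sum.elim_inr]
    split_ifs <;> simp
  have hsum : ∀ g : D.Row S T → ℝ,
      ∑ i, ((∑ U with ρ U = i, y₀ U + e i : ℤ) : ℝ) * g i =
        ∑ U, (y₀ U : ℝ) * g (ρ U) +
          ∑ a, ((if 0 ≤ l a then 0 else max (σ a) 0 : ℤ) : ℝ) * g (.inr (.inr (.inr a))) := by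
    intro g
    simp only [Int.cast_add, Int.cast_sum, add_mul, sum_add_distrib]
    congr 1
    · rw [← sum_fiberwise univ ρ fun U => (y₀ U : ℝ) * g (ρ U)]
      refine sum_congr rfl fun i _ => ?_
      rw [sum_mul]
      refine sum_congr rfl fun U hU => ?_
      rw [(mem_filter.mp hU).2]
    · simp [Fintype.sum_sum_type, e]
  have hcut : ∀ U a, (y₀ U : ℝ) * D.bibranchingMatrix S T (ρ U) a =
      y U * (if a ∈ D.cutArcs S T U then 1 else 0) := by
    intro U a
    by_cases h : U.Nonempty ∧ (U ⊆ T ∨ U ⊆ S)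
    · simp [y₀, h, bibranchingMatrix, (hρ U h).1]
    · have hem : D.cutArcs S T U = ∅ := by
        by_cases hU : U.Nonempty
        · rw [cutArcs, if_neg fun h' => h ⟨hU, .inl h'⟩, if_neg fun h' => h ⟨hU, .inr h'⟩]
        · rw [not_nonempty_iff_eq_empty.mp hU]
          simp [cutArcs, deltaIn]
      simp [y₀, h, hem]
  have hdem : ∀ U, (y₀ U : ℝ) * D.bibranchingRhs S T b (ρ U) = y U * demand S T b U := by
    intro U
    by_cases h : U.Nonempty ∧ (U ⊆ T ∨ U ⊆ S)
    · simp [y₀, h, (hρ U h).2]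
    · simp [y₀, h, demand]
  refine ⟨Sum.elim (fun i => ∑ U with ρ U = i, y₀ U + e i)
    (Sum.elim (fun a => if 0 ≤ l a then max (σ a) 0 else 0) fun a => max (-σ a) 0), ?_, ?_, ?_⟩
  · rintro (i | a | a)
    · refine add_nonneg (sum_nonneg fun U _ => ?_) (he i)
      simp only [y₀]
      split_ifs
      exacts [hy U, le_rfl]
    · simp only [Sum.elim_inr, Sum.elim_inl]
      split_ifs <;> simp
    · simp
  · intro a
    simp only [Fintype.sum_sum_type (α₁ := D.Row S T), Fintype.sum_sum_type (α₁ := A) (α₂ := A),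
      Sum.elim_inl, Sum.elim_inr, Matrix.fromRows_apply_inl, Matrix.fromRows_apply_inr]
    rw [hsum fun i => D.bibranchingMatrix S T i a]
    simp only [hcut]
    rw [← hw a]
    have hσ : (σ a : ℝ) = ((max (σ a) 0 : ℤ) : ℝ) - ((max (-σ a) 0 : ℤ) : ℝ) := by
      rw [← Int.cast_sub]
      congr 1
      omega
    push_cast at hσ
    by_cases h : 0 ≤ l a <;> simp [bibranchingMatrix, rowArcs, Matrix.one_apply, h] <;> linarith
  · intro z hz hzw
    -- A competitor `z` is pushed forward along `τ`, with its multipliers of x(a) ≥ 0 and x(a) ≥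
    -- l(a) added; this does not lower its value.
    have hz1 := hopt (fun U => ∑ i with τ i = U, z (.inl i))
      (fun a => z (.inl (.inr (.inr (.inr a)))) + z (.inr (.inl a))) (fun a => z (.inr (.inr a)))
      (fun U => sum_nonneg fun i _ => hz _) (fun a => add_nonneg (hz _) (hz _)) (fun a => hz _)
    have hfib : ∀ g : Finset V → ℝ, ∑ U, (∑ i with τ i = U, z (.inl i)) * g U =
        ∑ i, z (.inl i) * g (τ i) := by
      intro g
      rw [← sum_fiberwise univ τ fun i => z (.inl i) * g (τ i)]
      refine sum_congr rfl fun U _ => ?_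
      rw [sum_mul]
      refine sum_congr rfl fun i hi => ?_
      rw [(mem_filter.mp hi).2]
    have hz2 := hz1 (by
      intro a
      rw [hfib, ← hzw a]
      simp only [Fintype.sum_sum_type (α₁ := D.Row S T), Fintype.sum_sum_type (α₁ := A) (α₂ := A),
        Matrix.fromRows_apply_inl, Matrix.fromRows_apply_inr]
      have : ∑ i, z (.inl i) * D.bibranchingMatrix S T i a =
          ∑ i, z (.inl i) * (if a ∈ D.cutArcs S T (τ i) then 1 else 0) +
            z (.inl (.inr (.inr (.inr a)))) := by
        simp only [hτM, mul_add, sum_add_distrib]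
        congr 1
        simp [Fintype.sum_sum_type]
      rw [this]
      simp [Matrix.one_apply]
      ring)
    rw [hfib] at hz2
    simp only [Fintype.sum_sum_type (α₁ := D.Row S T), Fintype.sum_sum_type (α₁ := A) (α₂ := A),
      Sum.elim_inl, Sum.elim_inr]
    rw [hsum fun i => D.bibranchingRhs S T b i]
    simp only [hdem]
    have h1 : ∑ i, z (.inl i) * D.bibranchingRhs S T b i ≤
        ∑ i, z (.inl i) * demand S T b (τ i) :=
      sum_le_sum fun i _ => mul_le_mul_of_nonneg_left (hτr i) (hz _)
    have h2 : ∑ a, z (.inr (.inl a)) * l a ≤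
        ∑ a, (z (.inl (.inr (.inr (.inr a)))) + z (.inr (.inl a))) * max (l a) 0 := by
      refine sum_le_sum fun a _ => ?_
      have e1 := mul_nonneg (hz (.inl (.inr (.inr (.inr a))))) (le_max_right (l a) 0)
      have e2 := mul_le_mul_of_nonneg_left (le_max_left (l a) 0) (hz (.inr (.inl a)))
      linarith
    have h3 : ∑ a, ((max (σ a) 0 : ℤ) : ℝ) * max (l a) 0 =
        ∑ a, ((if 0 ≤ l a then max (σ a) 0 else 0 : ℤ) : ℝ) * l a := by
      refine sum_congr rfl fun a _ => ?_
      by_cases h : 0 ≤ l a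
      · rw [if_pos h, max_eq_left h]
      · rw [if_neg h, max_eq_right (le_of_not_ge h)]; simp
    have h4 : ∑ a, ((if 0 ≤ l a then 0 else max (σ a) 0 : ℤ) : ℝ) *
        D.bibranchingRhs S T b (.inr (.inr (.inr a))) = 0 := by
      simp [bibranchingRhs]
    simp only [Pi.neg_apply, mul_neg, sum_neg_distrib]
    rw [h4]
    linarith
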